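/- Let $p\in[1,\infty)$, and let $P_0$ be a probability measure on $\mathbb R$ with Lebesgue density $p_0$ and finite absolute moment $M_p(P_0)<\infty$, where $M_p(P)=\int |x|^p\,dP(x)\in[0,\infty]$. Let $X_1,X_2,\dots$ be i.i.d. with law $P_0$. Let $\mathcal F$ be a set of probability densities on $\mathbb R$ with the Borel $\sigma$-algebra of the weak topology (weak convergence of the corresponding laws), such that $(f,x)\mapsto f(x)$ is jointly measurable on $\mathcal F\times\mathbb R$. For each $n$ let $\Pi_n$ be a probability measure (prior) on $\mathcal F$, with posterior $$\Pi_n(A\mid X_1,\dots,X_n)=\frac{\int_A\prod_{i=1}^n f(X_i)/p_0(X_i)\,d\Pi_n(f)}{\int_{\mathcal F}\prod_{i=1}^n f(X_i)/p_0(X_i)\,d\Pi_n(f)},\qquad A\subset\mathcal F.$$ For $f\in\mathcal F$ write $P_f$ for the probability measure with density $f$. Suppose that the Kullback--Leibler support condition holds: $$\liminf_{n\to\infty}\Pi_n\bigl(f: K(p_0,f)<\epsilon\bigr)>0\quad\text{for every }\epsilon>0,\qquad K(p_0,f)=\int\log\frac{p_0}{f}\,dP_0 .$$ Then the following two statements are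 equivalent: 1. (consistency of the $p$-th moment) for every $\epsilon>0$, $\ \Pi_n\bigl(f:|M_p(P_f)-M_p(P_0)|>\epsilon\mid X_1,\dots,X_n\bigr)\to0$ in probability as $n\to\infty$; 2. (consistency in $W_p$) for every $\epsilon>0$, $\ \Pi_n\bigl(f:W_p(P_f,P_0)\ge\epsilon\mid X_1,\dots,X_n\bigr)\to0$ in probability as $n\to\infty$. Here $W_p(P,Q)=\inf_\pi\bigl(\int|x-y|^p\,d\pi(x,y)\bigr)^{1/p}\in[0,\infty]$, the infimum being over all couplings $\pi$ of $P$ and $Q$, and $|M_p(P_f)-M_p(P_0)|=\infty$ if $M_p(P_f)=\infty$. -/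

import Mathlib

open MeasureTheory ProbabilityTheory Filter Topology
open scoped ENNReal

noncomputable section

/-- A probability density on the real line with respect to Lebesgue measure. -/
structure ProbDensity where
  toFun : ℝ → ℝ
  measurable' : Measurable toFun
  nonneg' : ∀ x, 0 ≤ toFun x
  lintegral_eq_one' : ∫⁻ x, ENNReal.ofReal (toFun x) = 1

namespace ProbDensity

instance : CoeFun ProbDensity (fun _ => ℝ → ℝ) := ⟨toFun⟩

/-- The probability measure with density `f`. -/
def law (f : ProbDensity) : ProbabilityMeasure ℝ :=
  ⟨volume.withDensity (fun x => ENNReal.ofReal (f x)),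
    ⟨by rw [withDensity_apply _ MeasurableSet.univ, Measure.restrict_univ]
        exact f.lintegral_eq_one'⟩⟩

/-- The weak topology on densities: the topology of weak convergence of the associated laws. -/
instance : TopologicalSpace ProbDensity :=
  TopologicalSpace.induced law inferInstance

/-- The Borel σ-algebra of the weak topology. A set `F` of densities carries the subspace
topology and the trace σ-algebra, which is the Borel σ-algebra of the subspace topology. -/
instance : MeasurableSpace ProbDensity := borel ProbDensity

instance : BorelSpace ProbDensity := ⟨rfl⟩

end ProbDensity

/-- The absolute moment `M_p(P) = ∫ |x|^p dP(x)`, with values in `[0, ∞]`. -/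
def absMoment (p : ℝ) (P : Measure ℝ) : ℝ≥0∞ :=
  ∫⁻ x, ENNReal.ofReal (|x| ^ p) ∂P

/-- The absolute difference `|a - b|` in `[0, ∞]`; it is `∞` if exactly one of `a`, `b` is `∞`
(the subtraction of `ℝ≥0∞` is truncated at `0`). -/
def absDiff (a b : ℝ≥0∞) : ℝ≥0∞ := max (a - b) (b - a)

/-- `π` is a coupling of `P` and `Q`. -/
def IsCoupling (π : Measure (ℝ × ℝ)) (P Q : Measure ℝ) : Prop :=
  π.map Prod.fst = P ∧ π.map Prod.snd = Q

/-- The Wasserstein metric of order `p`, with values in `[0, ∞]`. -/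
def wasserstein (p : ℝ) (P Q : Measure ℝ) : ℝ≥0∞ :=
  ⨅ (π : Measure (ℝ × ℝ)) (_ : IsCoupling π P Q),
    (∫⁻ z, ENNReal.ofReal (|z.1 - z.2| ^ p) ∂π) ^ (1 / p)

/-- The likelihood ratio `∏_{i < n} f(x_i) / f₀(x_i)` of the first `n` observations. -/
def likelihoodRatio (f₀ f : ProbDensity) (n : ℕ) (x : ℕ → ℝ) : ℝ :=
  ∏ i ∈ Finset.range n, f (x i) / f₀ (x i)

/-- The posterior probability of `A`, given the first `n` terms of `x`, for the prior `prior`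
on the set `F` of densities (Bayes formula). -/
def posterior {F : Set ProbDensity} (f₀ : ProbDensity) (prior : Measure F) (n : ℕ) (x : ℕ → ℝ)
    (A : Set F) : ℝ≥0∞ :=
  (∫⁻ f in A, ENNReal.ofReal (likelihoodRatio f₀ f n x) ∂prior) /
    ∫⁻ f, ENNReal.ofReal (likelihoodRatio f₀ f n x) ∂prior

/-- The Kullback--Leibler support condition for a sequence of priors:
`liminf_n Π_n {f : K(f₀, f) < ε} > 0` for every `ε > 0`. -/
def KLSupport {F : Set ProbDensity} (f₀ : ProbDensity) (prior : ℕ → Measure F) : Prop :=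
  ∀ ε : ℝ, 0 < ε →
    0 < liminf (fun n => prior n {f : F |
      InformationTheory.klDiv (f₀.law : Measure ℝ) (f.1.law : Measure ℝ) < ENNReal.ofReal ε}) atTop

/-- `Π_n(A | X_1, …, X_n) → 0` in probability. -/
def PosteriorVanishes {Ω : Type*} [MeasurableSpace Ω] (μ : Measure Ω) (X : ℕ → Ω → ℝ)
    {F : Set ProbDensity} (f₀ : ProbDensity) (prior : ℕ → Measure F) (A : Set F) : Prop :=
  TendstoInMeasure μ (fun n ω => (posterior f₀ (prior n) n (fun i => X i ω) A).toReal) atTop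
    (fun _ => 0)

/-- Posterior consistency of the absolute moment of order `p`. -/
def MomentConsistent {Ω : Type*} [MeasurableSpace Ω] (μ : Measure Ω) (X : ℕ → Ω → ℝ)
    {F : Set ProbDensity} (f₀ : ProbDensity) (prior : ℕ → Measure F) (p : ℝ) : Prop :=
  ∀ ε : ℝ, 0 < ε → PosteriorVanishes μ X f₀ prior
    {f : F | ENNReal.ofReal ε < absDiff (absMoment p f.1.law) (absMoment p f₀.law)}

/-- Posterior consistency in the Wasserstein metric of order `p`. -/
def WassersteinConsistent {Ω : Type*} [MeasurableSpace Ω] (μ : Measure Ω) (X : ℕ → Ω → ℝ)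
    {F : Set ProbDensity} (f₀ : ProbDensity) (prior : ℕ → Measure F) (p : ℝ) : Prop :=
  ∀ ε : ℝ, 0 < ε → PosteriorVanishes μ X f₀ prior
    {f : F | ENNReal.ofReal ε ≤ wasserstein p f.1.law f₀.law}

end

/-! The implication from $W_p$ to moments is deterministic: by Minkowski's inequality $M_p^{1/p}$ is
1-Lipschitz for $W_p$ (`absMoment_rpow_le_add_wasserstein`), and $x\mapsto x^p$ is continuous.

The converse combines a deterministic reduction with Schwartz's theorem. For the reduction
(`exists_tests_wasserstein_lt`), cut a large interval into short cells. If $P$ gives each cell at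
least $1-\eta$ times its $Q$-mass, almost all of $Q$ on the interval can be coupled with $P$ inside
cells, at small cost; the remainders, coupled independently, cost at most $2^{p-1}(|x|^p+|y|^p)$.
This is small unless $P$ has moment far out. That is excluded when the total moments are close and
the integral of $|x|^p$ over the interval is not much smaller under $P$ than under $Q$. So, besides
the moment, finitely many one-sided inequalities for bounded functions suffice.

Each of these fails with vanishing posterior probability (`posteriorVanishes_lintegral_le`). If
$\int g\,dP_f\le t<\int g\,dP_0$, some affine function $v$ of $g$ satisfies $\int e^v dP_f\le
e^{-2\delta}$ and $\int e^{-v}dP_0\le e^{-2\delta}$. The weight $\prod e^{v(X_i)}$ exceeds 1 off a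
small event and brings the expected numerator below $e^{-2\delta n}$, while the denominator is at
least $c\,e^{-\delta n}$ with high probability (`exists_evidence_lower_bound`). -/

/-! ### Coupling inside cells -/

/-- A measure is the sum of its restrictions to finitely many disjoint sets and to the complement
of their union. -/
theorem restrict_compl_biUnion_add_sum_restrict {E ι : Type*} [MeasurableSpace E] (P : Measure E)
    (s : Finset ι) (A : ι → Set E) (hA : ∀ i, MeasurableSet (A i))
    (hd : (s : Set ι).PairwiseDisjoint A) :
    P.restrict (⋃ i ∈ s, A i)ᶜ + ∑ i ∈ s, P.restrict (A i) = P := by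
  have h := Measure.restrict_biUnion_finset (μ := P) hd hA
  rw [Measure.sum_fintype, Finset.sum_coe_sort s (fun i => P.restrict (A i))] at h
  rw [← h]
  exact Measure.restrict_compl_add_restrict (s.measurableSet_biUnion fun i _ => hA i)

/-- If `P` dominates `w • Q` on each of finitely many disjoint cells, then most of the mass of `P`
and `Q` can be coupled inside the cells. The bound controls the transport cost of such a coupling. -/
theorem exists_coupling_lintegral_le {E ι : Type*} [MeasurableSpace E] (P Q : Measure E)
    [IsProbabilityMeasure P] [IsProbabilityMeasure Q] (s : Finset ι) (A : ι → Set E)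
    (hA : ∀ i, MeasurableSet (A i)) (hd : (s : Set ι).PairwiseDisjoint A) (w η : ℝ≥0∞)
    (hw : w + η = 1) (hPQ : ∀ i ∈ s, w * Q (A i) ≤ P (A i)) :
    ∃ π : Measure (E × E), π.map Prod.fst = P ∧ π.map Prod.snd = Q ∧
      ∀ (c : E × E → ℝ≥0∞) (u v : E → ℝ≥0∞) (a b : ℝ≥0∞), Measurable u → Measurable v →
        (∀ i ∈ s, ∀ z ∈ A i ×ˢ A i, c z ≤ a) → (∀ z, c z ≤ u z.1 + v z.2) →
        (∀ i ∈ s, ∀ x ∈ A i, u x ≤ b) →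
        ∫⁻ z, c z ∂π ≤ a + (∫⁻ x in (⋃ i ∈ s, A i)ᶜ, u x ∂P) + b * (Q (⋃ i ∈ s, A i)ᶜ + η)
          + (∫⁻ y in (⋃ i ∈ s, A i)ᶜ, v y ∂Q) + η * ∫⁻ y, v y ∂Q := by
  set U := ⋃ i ∈ s, A i with hU
  -- The product in cell `i`, scaled by `r i`, has second marginal `w • Q` on the cell and first
  -- marginal at most `P` there. If `P (A i) = 0`, then `w * Q (A i) = 0`, so the value of `w / 0`
  -- is harmless.
  set r : ι → ℝ≥0∞ := fun i => w / P (A i) with hr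
  have hr1 : ∀ i ∈ s, r i * Q (A i) ≤ 1 := fun i hi => by
    rw [hr, ← ENNReal.mul_div_right_comm]
    exact ENNReal.div_le_of_le_mul (by simpa using hPQ i hi)
  have hrP : ∀ i ∈ s, P (A i) ≠ 0 → r i * P (A i) = w := fun i _ h =>
    ENNReal.div_mul_cancel h (measure_ne_top _ _)
  set νP := P.restrict Uᶜ + ∑ i ∈ s, (1 - r i * Q (A i)) • P.restrict (A i) with hνP
  set νQ := Q.restrict Uᶜ + ∑ i ∈ s, η • Q.restrict (A i) with hνQ
  set κ := ∑ i ∈ s, r i • (P.restrict (A i)).prod (Q.restrict (A i)) with hκ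
  have hκ1 : κ.map Prod.fst = ∑ i ∈ s, (r i * Q (A i)) • P.restrict (A i) := by
    rw [hκ, Measure.map_finset_sum measurable_fst.aemeasurable]
    refine Finset.sum_congr rfl fun i _ => ?_
    rw [Measure.map_smul, Measure.map_fst_prod, Measure.restrict_apply_univ, smul_smul]
  have hκ2 : κ.map Prod.snd = ∑ i ∈ s, w • Q.restrict (A i) := by
    rw [hκ, Measure.map_finset_sum measurable_snd.aemeasurable]
    refine Finset.sum_congr rfl fun i hi => ?_
    rw [Measure.map_smul, Measure.map_snd_prod, Measure.restrict_apply_univ, smul_smul]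
    by_cases h : P (A i) = 0
    · have h1 := hPQ i hi
      rw [h] at h1
      rw [h, mul_zero, zero_smul]
      rcases mul_eq_zero.1 (le_antisymm h1 zero_le) with h2 | h2
      · rw [h2, zero_smul]
      · rw [Measure.restrict_eq_zero.2 h2, smul_zero]
    · rw [hrP i hi h]
  have hP : κ.map Prod.fst + νP = P := by
    conv_rhs => rw [← restrict_compl_biUnion_add_sum_restrict P s A hA hd]
    rw [hκ1, hνP, add_left_comm, ← Finset.sum_add_distrib]
    congr 1
    refine Finset.sum_congr rfl fun i hi => ?_
    rw [← add_smul, add_tsub_cancel_of_le (hr1 i hi), one_smul]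
  have hQ : κ.map Prod.snd + νQ = Q := by
    conv_rhs => rw [← restrict_compl_biUnion_add_sum_restrict Q s A hA hd]
    rw [hκ2, hνQ, add_left_comm, ← Finset.sum_add_distrib]
    congr 1
    refine Finset.sum_congr rfl fun i hi => ?_
    rw [← add_smul, hw, one_smul]
  have hκP : κ Set.univ + νP Set.univ = 1 := by
    have := congrArg (fun m : Measure E => m Set.univ) hP
    simpa [Measure.map_apply measurable_fst] using this
  have hκQ : κ Set.univ + νQ Set.univ = 1 := by
    have := congrArg (fun m : Measure E => m Set.univ) hQ
    simpa [Measure.map_apply measurable_snd] using this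
  have hκle : κ Set.univ ≤ 1 := hκP ▸ le_self_add
  have hmass : νP Set.univ = νQ Set.univ :=
    (ENNReal.add_right_inj (ne_top_of_le_ne_top ENNReal.one_ne_top hκle)).1 (hκP.trans hκQ.symm)
  have : IsFiniteMeasure νP := ⟨(hκP ▸ le_add_self : νP Set.univ ≤ 1).trans_lt ENNReal.one_lt_top⟩
  have : IsFiniteMeasure νQ := ⟨(hκQ ▸ le_add_self : νQ Set.univ ≤ 1).trans_lt ENNReal.one_lt_top⟩
  -- The remainders have equal mass and are coupled independently. If that mass is 0, both vanish
  -- and the factor `∞` does no harm.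
  set ρ := (νP Set.univ)⁻¹ • νP.prod νQ with hρ
  have hρ1 : ρ.map Prod.fst = νP := by
    rw [hρ, Measure.map_smul, Measure.map_fst_prod, smul_smul, ← hmass]
    by_cases h : νP Set.univ = 0
    · rw [Measure.measure_univ_eq_zero.1 h, smul_zero]
    · rw [ENNReal.inv_mul_cancel h (measure_ne_top _ _), one_smul]
  have hρ2 : ρ.map Prod.snd = νQ := by
    rw [hρ, Measure.map_smul, Measure.map_snd_prod, smul_smul]
    by_cases h : νP Set.univ = 0
    · rw [Measure.measure_univ_eq_zero.1 (hmass.symm.trans h), smul_zero]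
    · rw [ENNReal.inv_mul_cancel h (measure_ne_top _ _), one_smul]
  refine ⟨κ + ρ, ?_, ?_, fun c u v a b hu hv hca hcuv hub => ?_⟩
  · rw [Measure.map_add _ _ measurable_fst, hρ1, hP]
  · rw [Measure.map_add _ _ measurable_snd, hρ2, hQ]
  have hcκ : ∫⁻ z, c z ∂κ ≤ a := by
    have hle : ∫⁻ z, c z ∂κ ≤ ∫⁻ _, a ∂κ := by
      simp only [hκ, lintegral_finsetSum_measure, lintegral_smul_measure, Measure.prod_restrict]
      refine Finset.sum_le_sum fun i hi => ?_
      gcongr 1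
      exact setLIntegral_mono' ((hA i).prod (hA i)) fun z hz => hca i hi z hz
    refine hle.trans ?_
    rw [lintegral_const]
    exact mul_le_of_le_one_right zero_le hκle
  have hcρ : ∫⁻ z, c z ∂ρ ≤ (∫⁻ x, u x ∂νP) + ∫⁻ y, v y ∂νQ := by
    rw [← hρ1, ← hρ2, lintegral_map hu measurable_fst, lintegral_map hv measurable_snd,
      ← lintegral_add_left (f := fun z : E × E => u z.1) (hu.comp measurable_fst)]
    exact lintegral_mono hcuv
  -- Inside the cells `u ≤ b`, and the mass of `νP` is that of `νQ`, which is at most `Q Uᶜ + η`.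
  have huP : ∫⁻ x, u x ∂νP ≤ (∫⁻ x in Uᶜ, u x ∂P) + b * (Q Uᶜ + η) := by
    rw [hνP, lintegral_add_measure]
    gcongr
    calc ∫⁻ x, u x ∂(∑ i ∈ s, (1 - r i * Q (A i)) • P.restrict (A i))
        ≤ ∫⁻ _, b ∂(∑ i ∈ s, (1 - r i * Q (A i)) • P.restrict (A i)) := by
          simp only [lintegral_finsetSum_measure, lintegral_smul_measure]
          refine Finset.sum_le_sum fun i hi => ?_
          gcongr 1
          exact setLIntegral_mono' (hA i) fun z hz => hub i hi z hz
      _ ≤ b * νP Set.univ := by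
          rw [lintegral_const, hνP, Measure.add_apply]
          gcongr
          exact le_add_self
      _ ≤ b * (Q Uᶜ + η) := by
          rw [hmass, hνQ, Measure.add_apply, Measure.restrict_apply_univ, ← Finset.smul_sum,
            Measure.smul_apply, smul_eq_mul]
          gcongr
          refine mul_le_of_le_one_right zero_le ?_
          have h1 := restrict_compl_biUnion_add_sum_restrict Q s A hA hd
          calc (∑ i ∈ s, Q.restrict (A i)) Set.univ ≤ Q Set.univ := by
                conv_rhs => rw [← h1]
                exact le_add_self
            _ = 1 := measure_univ
  have hvQ : ∫⁻ y, v y ∂νQ ≤ (∫⁻ y in Uᶜ, v y ∂Q) + η * ∫⁻ y, v y ∂Q := by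
    rw [hνQ, lintegral_add_measure, ← Finset.smul_sum, lintegral_smul_measure, smul_eq_mul]
    gcongr
    conv_rhs => rw [← restrict_compl_biUnion_add_sum_restrict Q s A hA hd]
    exact Measure.le_add_left le_rfl
  rw [lintegral_add_measure]
  calc (∫⁻ z, c z ∂κ) + ∫⁻ z, c z ∂ρ
      ≤ a + (((∫⁻ x in Uᶜ, u x ∂P) + b * (Q Uᶜ + η)) +
        ((∫⁻ y in Uᶜ, v y ∂Q) + η * ∫⁻ y, v y ∂Q)) :=
        add_le_add hcκ (hcρ.trans (add_le_add huP hvQ))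
    _ = _ := by ring

/-! ### Continuity of the moment in the Wasserstein metric -/

/-- Minkowski's inequality for couplings, for the first marginal. -/
theorem absMoment_rpow_le_add_of_isCoupling {p : ℝ} (hp : 1 ≤ p) {P Q : Measure ℝ}
    {π : Measure (ℝ × ℝ)} (hπ : IsCoupling π P Q) :
    absMoment p P ^ (1 / p) ≤ absMoment p Q ^ (1 / p) +
      (∫⁻ z, ENNReal.ofReal (|z.1 - z.2| ^ p) ∂π) ^ (1 / p) := by
  have hp0 : 0 ≤ p := by linarith
  have hm : Measurable fun x : ℝ => ENNReal.ofReal (|x| ^ p) := by fun_prop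
  rw [← hπ.1, ← hπ.2, absMoment, absMoment, lintegral_map hm measurable_fst,
    lintegral_map hm measurable_snd]
  simp only [← ENNReal.ofReal_rpow_of_nonneg (abs_nonneg _) hp0]
  refine le_trans ?_ (ENNReal.lintegral_Lp_add_le (f := fun z : ℝ × ℝ => ENNReal.ofReal |z.2|)
    (g := fun z : ℝ × ℝ => ENNReal.ofReal |z.1 - z.2|) (by fun_prop) (by fun_prop) hp)
  gcongr with z
  rw [Pi.add_apply, ← ENNReal.ofReal_add (abs_nonneg _) (abs_nonneg _)]
  gcongr
  simpa using abs_add_le z.2 (z.1 - z.2)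

/-- The coupling with exchanged coordinates. -/
theorem IsCoupling.swap {P Q : Measure ℝ} {π : Measure (ℝ × ℝ)} (hπ : IsCoupling π P Q) :
    IsCoupling (π.map Prod.swap) Q P := by
  constructor
  · rw [Measure.map_map measurable_fst measurable_swap, ← hπ.2]; rfl
  · rw [Measure.map_map measurable_snd measurable_swap, ← hπ.1]; rfl

theorem wasserstein_comm (p : ℝ) (P Q : Measure ℝ) : wasserstein p P Q = wasserstein p Q P := by
  have key : ∀ P Q : Measure ℝ, wasserstein p P Q ≤ wasserstein p Q P := fun P Q => by
    refine le_iInf₂ fun π hπ => ?_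
    refine le_trans (iInf₂_le (π.map Prod.swap) hπ.swap) ?_
    rw [lintegral_map (by fun_prop) measurable_swap]
    simp only [Prod.fst_swap, Prod.snd_swap, abs_sub_comm, le_refl]
  exact le_antisymm (key P Q) (key Q P)

theorem absMoment_rpow_le_add_wasserstein {p : ℝ} (hp : 1 ≤ p) (P Q : Measure ℝ) :
    absMoment p P ^ (1 / p) ≤ absMoment p Q ^ (1 / p) + wasserstein p P Q := by
  rw [wasserstein]
  simp only [ENNReal.add_iInf]
  exact le_iInf₂ fun π hπ => absMoment_rpow_le_add_of_isCoupling hp hπ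

/-- Closeness in the Wasserstein metric forces closeness of the absolute moments. -/
theorem exists_absDiff_le_of_wasserstein_lt {p : ℝ} (hp : 1 ≤ p) {Q : Measure ℝ}
    (hQ : absMoment p Q < ∞) {ε : ℝ} (hε : 0 < ε) :
    ∃ δ : ℝ, 0 < δ ∧ ∀ P : Measure ℝ, wasserstein p P Q < ENNReal.ofReal δ →
      absDiff (absMoment p P) (absMoment p Q) ≤ ENNReal.ofReal ε := by
  have hp0 : 0 < p := by linarith
  set q := absMoment p Q ^ (1 / p) with hq
  have hqt : q ≠ ∞ := ENNReal.rpow_ne_top_of_nonneg (by positivity) hQ.ne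
  have hqp : ∀ P : Measure ℝ, (absMoment p P ^ (1 / p)) ^ p = absMoment p P := fun P => by
    rw [one_div, ENNReal.rpow_inv_rpow hp0.ne']
  have h1 : Set.Icc (absMoment p Q - ENNReal.ofReal ε) (absMoment p Q + ENNReal.ofReal ε)
      ∈ 𝓝 (q ^ p) := by
    rw [hq, hqp]
    exact ENNReal.Icc_mem_nhds hQ.ne (by simpa using hε)
  have h2 := (ENNReal.continuous_rpow_const (y := p)).continuousAt.preimage_mem_nhds h1
  obtain ⟨δ, hδ, hsub⟩ := (ENNReal.hasBasis_nhds_of_ne_top hqt).mem_iff.1 h2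
  -- The radius `δ` from the neighbourhood basis may be `∞`.
  have hδ' : min δ 1 ≠ ∞ := by simp
  refine ⟨(min δ 1).toReal, ENNReal.toReal_pos (by simp [hδ.ne']) hδ', fun P hP => ?_⟩
  rw [ENNReal.ofReal_toReal hδ'] at hP
  have hP' : wasserstein p P Q ≤ δ := hP.le.trans (min_le_left _ _)
  have hmem : absMoment p P ^ (1 / p) ∈ Set.Icc (q - δ) (q + δ) := by
    constructor
    · rw [tsub_le_iff_right]
      refine (absMoment_rpow_le_add_wasserstein hp Q P).trans ?_
      rw [wasserstein_comm]
      gcongr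
    · exact (absMoment_rpow_le_add_wasserstein hp P Q).trans (by gcongr)
  have h3 := hsub hmem
  rw [Set.mem_preimage, hqp] at h3
  refine max_le ?_ ?_
  · rw [tsub_le_iff_left]; exact h3.2
  · rw [tsub_le_iff_left, add_comm, ← tsub_le_iff_left, tsub_le_iff_left, add_comm,
      ← tsub_le_iff_right]; exact h3.1

/-! ### Wasserstein closeness from finitely many tests -/

/-- The tails of a finite integral vanish. -/
theorem exists_setLIntegral_compl_floor_le {Q : Measure ℝ} {g : ℝ → ℝ≥0∞} (hg : Measurable g)
    (hfin : ∫⁻ x, g x ∂Q ≠ ∞) (h : ℝ) {d : ℝ≥0∞} (hd : d ≠ 0) :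
    ∃ K : ℕ, ∫⁻ x in (⋃ j ∈ Finset.Ico (-(K : ℤ)) K, {x : ℝ | ⌊x / h⌋ = j})ᶜ, g x ∂Q ≤ d := by
  have hmeas : ∀ j : ℤ, MeasurableSet {x : ℝ | ⌊x / h⌋ = j} := fun j =>
    measurableSet_eq_fun (by fun_prop) measurable_const
  have hU : ∀ K : ℕ, MeasurableSet (⋃ j ∈ Finset.Ico (-(K : ℤ)) K, {x : ℝ | ⌊x / h⌋ = j}) :=
    fun K => Finset.measurableSet_biUnion _ fun j _ => hmeas j
  have hlim : Tendsto (fun K : ℕ =>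
      ∫⁻ x, (⋃ j ∈ Finset.Ico (-(K : ℤ)) K, {x : ℝ | ⌊x / h⌋ = j})ᶜ.indicator g x ∂Q)
      atTop (𝓝 (∫⁻ _, 0 ∂Q)) := by
    refine tendsto_lintegral_of_dominated_convergence g (fun K => hg.indicator (hU K).compl)
      (fun K => ae_of_all _ fun x => Set.indicator_le_self _ _ _) hfin (ae_of_all _ fun x => ?_)
    refine tendsto_const_nhds.congr' ?_
    filter_upwards [eventually_ge_atTop (⌊x / h⌋.natAbs + 1)] with K hK
    rw [Set.indicator_of_notMem]
    simp only [Set.mem_compl_iff, Set.mem_iUnion, Finset.mem_Ico, Set.mem_ofPred_eq, not_not]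
    exact ⟨⌊x / h⌋, by omega, rfl⟩
  rw [lintegral_zero] at hlim
  obtain ⟨K, hK⟩ := (hlim.eventually_lt_const (pos_iff_ne_zero.2 hd)).exists
  refine ⟨K, ?_⟩
  rw [← lintegral_indicator (hU K).compl]
  exact hK.le

/-- Closeness of the absolute moments, together with finitely many one-sided inequalities for
integrals of bounded functions, forces closeness in the Wasserstein metric. -/
theorem exists_tests_wasserstein_lt {p : ℝ} (hp : 1 ≤ p) (Q : Measure ℝ) [IsProbabilityMeasure Q]
    (hQ : absMoment p Q < ∞) {ε : ℝ} (hε : 0 < ε) :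
    ∃ (δ : ℝ) (w : ℝ≥0∞) (G : Finset (ℝ → ℝ≥0∞)), 0 < δ ∧ w < 1 ∧
      (∀ g ∈ G, Measurable g ∧ ∃ C : ℝ≥0∞, C ≠ ∞ ∧ ∀ x, g x ≤ C) ∧
      ∀ P : Measure ℝ, IsProbabilityMeasure P →
        absDiff (absMoment p P) (absMoment p Q) ≤ ENNReal.ofReal δ →
        (∀ g ∈ G, w * ∫⁻ x, g x ∂Q ≤ ∫⁻ x, g x ∂P) → wasserstein p P Q < ENNReal.ofReal ε := by
  classical
  have hp0 : 0 < p := by linarith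
  set φ : ℝ → ℝ≥0∞ := fun x => ENNReal.ofReal (|x| ^ p) with hφ
  have hφm : Measurable φ := by fun_prop
  have hM : ∫⁻ x, φ x ∂Q ≠ ∞ := hQ.ne
  set M := ∫⁻ x, φ x ∂Q with hMdef
  set B := ENNReal.ofReal (ε ^ p) with hB
  have hB0 : B ≠ 0 := by simp only [hB, ne_eq, ENNReal.ofReal_eq_zero, not_le]; positivity
  have hBt : B ≠ ∞ := ENNReal.ofReal_ne_top
  set c₀ : ℝ≥0∞ := 2 ^ (p - 1) with hc₀
  have hc0 : c₀ ≠ 0 := by simp [hc₀]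
  have hct : c₀ ≠ ∞ := ENNReal.rpow_ne_top_of_nonneg (by linarith) (by simp)
  -- The budget `B = ε ^ p` is cut in thirds: one for the cells (`h ^ p = B / 3`), one for five
  -- errors of size `c₀ * d`, one to keep the final inequality strict.
  set d : ℝ≥0∞ := B / 3 / (5 * c₀) with hd
  have hd0 : d ≠ 0 := ENNReal.div_ne_zero.2
    ⟨ENNReal.div_ne_zero.2 ⟨hB0, by simp⟩, ENNReal.mul_ne_top (by simp) hct⟩
  have hdt : d ≠ ∞ := ENNReal.div_ne_top (ENNReal.div_ne_top hBt (by simp)) (by simp [hc0])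
  have hdc : 5 * c₀ * d ≤ B / 3 := ENNReal.mul_div_le
  set h : ℝ := (ε ^ p / 3) ^ (1 / p) with hh
  have hh0 : 0 < h := by positivity
  have hhp : ENNReal.ofReal (h ^ p) = B / 3 := by
    rw [hh, ← Real.rpow_mul (by positivity), one_div_mul_cancel hp0.ne', Real.rpow_one,
      ENNReal.ofReal_div_of_pos (by norm_num)]
    simp [hB]
  obtain ⟨K, hK⟩ := exists_setLIntegral_compl_floor_le hφm hM h hd0
  set A : ℤ → Set ℝ := fun j => {x : ℝ | ⌊x / h⌋ = j} with hA
  have hAm : ∀ j, MeasurableSet (A j) := fun j =>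
    measurableSet_eq_fun (by fun_prop) measurable_const
  set J := Finset.Ico (-(K : ℤ)) K with hJ
  have hAd : (J : Set ℤ).PairwiseDisjoint A := fun i _ j _ hij =>
    Set.disjoint_left.2 fun x hi hj => hij (hi.symm.trans hj)
  change ∫⁻ x in (⋃ j ∈ J, A j)ᶜ, φ x ∂Q ≤ d at hK
  set U := ⋃ j ∈ J, A j with hU
  have hUm : MeasurableSet U := Finset.measurableSet_biUnion _ fun j _ => hAm j
  set R := ENNReal.ofReal ((K * h) ^ p) with hR
  have hφR : ∀ j ∈ J, ∀ x ∈ A j, φ x ≤ R := fun j hj x hx => by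
    have hx' : ⌊x / h⌋ = j := hx
    rw [hJ, Finset.mem_Ico] at hj
    have h1 : ((-(K : ℤ) : ℤ) : ℝ) ≤ x / h := (Int.cast_le.2 (hx' ▸ hj.1)).trans (Int.floor_le _)
    have h2 : x / h < ((K : ℤ) : ℝ) := Int.floor_lt.1 (hx' ▸ hj.2)
    rw [le_div_iff₀ hh0] at h1
    rw [div_lt_iff₀ hh0] at h2
    push_cast at h1 h2
    refine ENNReal.ofReal_le_ofReal (Real.rpow_le_rpow (abs_nonneg _) ?_ hp0.le)
    exact abs_le.2 ⟨by linarith, h2.le⟩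
  have hRφ : ∀ x ∈ Uᶜ, R ≤ φ x := fun x hx => by
    refine ENNReal.ofReal_le_ofReal (Real.rpow_le_rpow (by positivity) ?_ hp0.le)
    by_contra hlt
    rw [not_le, abs_lt] at hlt
    refine hx (Set.mem_biUnion (x := ⌊x / h⌋) ?_ rfl)
    rw [hJ, Finset.coe_Ico, Set.mem_Ico, Int.le_floor, Int.floor_lt, le_div_iff₀ hh0,
      div_lt_iff₀ hh0]
    push_cast
    exact ⟨by linarith, hlt.2⟩
  -- All error terms with factor `η` add up to `η * (2 * M + R)`, which this choice keeps below `d`.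
  set η : ℝ≥0∞ := min 1 (d / (2 * M + R)) with hη
  have hη1 : η ≤ 1 := min_le_left _ _
  have hη0 : 0 < η := lt_min one_pos (ENNReal.div_pos hd0
    (ENNReal.add_ne_top.2 ⟨ENNReal.mul_ne_top (by simp) hM, ENNReal.ofReal_ne_top⟩))
  have hηd : η * (2 * M + R) ≤ d := by
    calc η * (2 * M + R) ≤ (2 * M + R) * (d / (2 * M + R)) := by
          rw [mul_comm]; gcongr; exact min_le_right _ _
      _ ≤ d := ENNReal.mul_div_le
  have hwη : 1 - η + η = 1 := tsub_add_cancel_of_le hη1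
  refine ⟨d.toReal, 1 - η, insert (U.indicator φ) (J.image fun j => (A j).indicator fun _ => 1),
    ENNReal.toReal_pos hd0 hdt, ENNReal.sub_lt_self (by simp) (by simp) hη0.ne', ?_, ?_⟩
  · intro g hg
    rcases Finset.mem_insert.1 hg with rfl | hg
    · refine ⟨hφm.indicator hUm, R, ENNReal.ofReal_ne_top, fun x => ?_⟩
      refine Set.indicator_le (f := φ) (g := fun _ => R) (s := U) (fun y hy => ?_) x
      obtain ⟨j, hj, hy⟩ := Set.mem_iUnion₂.1 hy
      exact hφR j hj y hy
    · obtain ⟨j, -, rfl⟩ := Finset.mem_image.1 hg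
      exact ⟨measurable_const.indicator (hAm j), 1, by simp,
        Set.indicator_le (g := fun _ => (1 : ℝ≥0∞)) fun _ _ => le_rfl⟩
  intro P hPp hmom hG
  rw [ENNReal.ofReal_toReal hdt] at hmom
  have hcell : ∀ j ∈ J, (1 - η) * Q (A j) ≤ P (A j) := fun j hj => by
    have := hG _ (Finset.mem_insert_of_mem (Finset.mem_image_of_mem _ hj))
    simpa [lintegral_indicator (hAm j)] using this
  have hbulk : (1 - η) * ∫⁻ x in U, φ x ∂Q ≤ ∫⁻ x in U, φ x ∂P := by
    have := hG _ (Finset.mem_insert_self _ _)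
    simpa [lintegral_indicator hUm] using this
  have hMP : ∫⁻ x, φ x ∂P ≤ M + d := by
    have h1 : absMoment p P - absMoment p Q ≤ d := (le_max_left _ _).trans hmom
    exact tsub_le_iff_left.1 h1
  -- No moment escapes: the total under `P` is at most `M + d`, and `U` already carries `1 - η` of
  -- its share under `Q`.
  have htail : ∫⁻ x in Uᶜ, φ x ∂P ≤ d + η * M + d := by
    have hfinU : ∫⁻ x in U, φ x ∂P ≠ ∞ :=
      ne_top_of_le_ne_top (ENNReal.add_ne_top.2 ⟨hM, hdt⟩) ((setLIntegral_le_lintegral _ _).trans hMP)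
    refine (ENNReal.add_le_add_iff_left hfinU).1 ?_
    calc (∫⁻ x in U, φ x ∂P) + ∫⁻ x in Uᶜ, φ x ∂P = ∫⁻ x, φ x ∂P := lintegral_add_compl _ hUm
      _ ≤ M + d := hMP
      _ = (1 - η + η) * (∫⁻ x in U, φ x ∂Q) + (∫⁻ x in Uᶜ, φ x ∂Q) + d := by
          rw [hwη, one_mul, lintegral_add_compl _ hUm]
      _ = (1 - η) * (∫⁻ x in U, φ x ∂Q) + η * (∫⁻ x in U, φ x ∂Q) + (∫⁻ x in Uᶜ, φ x ∂Q) + d := by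
          rw [add_mul]
      _ ≤ (∫⁻ x in U, φ x ∂P) + η * M + d + d := by
          gcongr
          exact setLIntegral_le_lintegral _ _
      _ = _ := by ring
  have hRT : R * Q Uᶜ ≤ d := by
    refine le_trans ?_ hK
    rw [← setLIntegral_const]
    exact setLIntegral_mono' hUm.compl hRφ
  obtain ⟨π, hπ1, hπ2, hπ⟩ := exists_coupling_lintegral_le P Q J A hAm hAd _ _ hwη hcell
  have hcost := hπ (fun z => ENNReal.ofReal (|z.1 - z.2| ^ p)) (fun x => c₀ * φ x)
    (fun x => c₀ * φ x) (B / 3) (c₀ * R) (hφm.const_mul _) (hφm.const_mul _) ?_ ?_ ?_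
  · have hlt : ∫⁻ z, ENNReal.ofReal (|z.1 - z.2| ^ p) ∂π < ENNReal.ofReal ε ^ p := by
      refine hcost.trans_lt ?_
      rw [lintegral_const_mul _ hφm, lintegral_const_mul _ hφm, lintegral_const_mul _ hφm,
        ENNReal.ofReal_rpow_of_pos hε]
      calc B / 3 + c₀ * (∫⁻ x in Uᶜ, φ x ∂P) + c₀ * R * (Q Uᶜ + η)
            + c₀ * (∫⁻ x in Uᶜ, φ x ∂Q) + η * (c₀ * M)
          = B / 3 + c₀ * ((∫⁻ x in Uᶜ, φ x ∂P) + R * Q Uᶜ + (∫⁻ x in Uᶜ, φ x ∂Q)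
            + η * (M + R)) := by ring
        _ ≤ B / 3 + c₀ * ((d + η * M + d) + d + d + η * (M + R)) := by gcongr
        _ = B / 3 + c₀ * (4 * d + η * (2 * M + R)) := by ring
        _ ≤ B / 3 + c₀ * (4 * d + d) := by gcongr
        _ = B / 3 + 5 * c₀ * d := by ring
        _ ≤ B / 3 + B / 3 := by gcongr
        _ < B / 3 + B / 3 + B / 3 := ENNReal.lt_add_right
            (by simp [ENNReal.div_eq_top, hBt]) (ENNReal.div_ne_zero.2 ⟨hB0, by simp⟩)
        _ = B := ENNReal.add_thirds B
    refine lt_of_le_of_lt (iInf₂_le π ⟨hπ1, hπ2⟩) ?_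
    refine (ENNReal.rpow_lt_rpow hlt (by positivity : 0 < 1 / p)).trans_eq ?_
    rw [one_div, ENNReal.rpow_rpow_inv hp0.ne']
  · rintro j - ⟨x, y⟩ ⟨hx, hy⟩
    have hx' : ⌊x / h⌋ = j := hx
    have hy' : ⌊y / h⌋ = j := hy
    rw [← hhp]
    refine ENNReal.ofReal_le_ofReal (Real.rpow_le_rpow (abs_nonneg _) ?_ hp0.le)
    have := Int.abs_sub_lt_one_of_floor_eq_floor (hx'.trans hy'.symm)
    rw [← sub_div, abs_div, abs_of_pos hh0, div_lt_one hh0] at this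
    exact this.le
  · rintro ⟨x, y⟩
    simp only [hφ, ← ENNReal.ofReal_rpow_of_nonneg (abs_nonneg _) hp0.le, ← mul_add]
    refine le_trans ?_ (ENNReal.rpow_add_le_mul_rpow_add_rpow _ _ hp)
    rw [← ENNReal.ofReal_add (abs_nonneg _) (abs_nonneg _)]
    gcongr
    exact abs_sub x y
  · intro j hj x hx
    gcongr
    exact hφR j hj x hx

/-! ### Likelihood ratios and Kullback--Leibler divergence -/

namespace ProbDensity

theorem measurable_ofReal (f : ProbDensity) : Measurable fun x => ENNReal.ofReal (f x) :=
  f.measurable'.ennreal_ofReal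

theorem coe_law (f : ProbDensity) :
    (f.law : Measure ℝ) = volume.withDensity fun x => ENNReal.ofReal (f x) := rfl

theorem lintegral_law (f : ProbDensity) {φ : ℝ → ℝ≥0∞} (hφ : Measurable φ) :
    ∫⁻ x, φ x ∂(f.law : Measure ℝ) = ∫⁻ x, ENNReal.ofReal (f x) * φ x := by
  rw [coe_law, lintegral_withDensity_eq_lintegral_mul _ f.measurable_ofReal hφ]
  rfl

/-- Change of measure by the likelihood ratio. -/
theorem lintegral_ratio_mul_le (f₀ f : ProbDensity) {φ : ℝ → ℝ≥0∞} (hφ : Measurable φ) :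
    ∫⁻ x, ENNReal.ofReal (f x / f₀ x) * φ x ∂(f₀.law : Measure ℝ) ≤
      ∫⁻ x, φ x ∂(f.law : Measure ℝ) := by
  have hm : Measurable fun x => ENNReal.ofReal (f x / f₀ x) * φ x :=
    (f.measurable'.div f₀.measurable').ennreal_ofReal.mul hφ
  rw [lintegral_law _ hm, lintegral_law _ hφ]
  refine lintegral_mono fun x => ?_
  rw [← mul_assoc, ← ENNReal.ofReal_mul (f₀.nonneg' x)]
  gcongr
  by_cases h : f₀ x = 0
  · rw [h, zero_mul]
    exact f.nonneg' x
  · rw [mul_div_cancel₀ _ h]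

end ProbDensity

/-- The positive part of `-log r`, with value `∞` at `r = 0`. -/
noncomputable def negLog (r : ℝ) : ℝ≥0∞ := if r = 0 then ∞ else ENNReal.ofReal (-Real.log r)

theorem measurable_negLog : Measurable negLog :=
  Measurable.ite (measurableSet_singleton 0) measurable_const
    Real.measurable_log.neg.ennreal_ofReal

theorem exp_neg_negLog_le {r : ℝ} (hr : 0 ≤ r) (h : negLog r ≠ ∞) :
    Real.exp (-(negLog r).toReal) ≤ r := by
  have hr0 : r ≠ 0 := fun h0 => h (if_pos h0)
  have hpos : 0 < r := lt_of_le_of_ne hr hr0.symm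
  rw [negLog, if_neg hr0, ENNReal.toReal_ofReal', ← Real.le_log_iff_exp_le hpos]
  linarith [le_max_left (-Real.log r) 0]

/-- Only the negative parts of the logarithms can make the product small, so a lower bound on the
likelihood ratio needs no control of the positive parts. -/
theorem exp_neg_le_prod {ι : Type*} {s : Finset ι} {r : ι → ℝ} (hr : ∀ i ∈ s, 0 ≤ r i) {a : ℝ}
    (ha : 0 ≤ a) (h : ∑ i ∈ s, negLog (r i) ≤ ENNReal.ofReal a) :
    Real.exp (-a) ≤ ∏ i ∈ s, r i := by
  have hfin : ∀ i ∈ s, negLog (r i) ≠ ∞ :=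
    ENNReal.sum_ne_top.1 (ne_top_of_le_ne_top ENNReal.ofReal_ne_top h)
  calc Real.exp (-a) ≤ Real.exp (-∑ i ∈ s, (negLog (r i)).toReal) := by
        rw [← ENNReal.toReal_sum hfin]
        have := ENNReal.toReal_le_of_le_ofReal ha h
        gcongr
    _ = ∏ i ∈ s, Real.exp (-(negLog (r i)).toReal) := by
        rw [← Finset.sum_neg_distrib, Real.exp_sum]
    _ ≤ ∏ i ∈ s, r i := Finset.prod_le_prod (fun _ _ => (Real.exp_pos _).le)
        fun i hi => exp_neg_negLog_le (hr i hi) (hfin i hi)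

-- Since `r * log r = klFun r + (r - 1)`, only the linear term needs care. The Young-type inequality
-- `r * (1 + t - log r) ≤ exp t ≤ 1 + t + t ^ 2` bounds it by `klFun r / t + t`.
open InformationTheory in
theorem mul_log_le_klFun {r t : ℝ} (hr : 1 ≤ r) (ht : 0 < t) (ht1 : t ≤ 1) :
    r * Real.log r ≤ (1 + 1 / t) * klFun r + t := by
  have h1 : Real.exp t ≤ 1 + t + t ^ 2 := by
    have := (abs_le.1 (Real.abs_exp_sub_one_sub_id_le (abs_le.2 ⟨by linarith, ht1⟩))).2
    linarith
  have h2 : r * (1 + t - Real.log r) ≤ Real.exp t := by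
    have h3 := Real.add_one_le_exp (t - Real.log r)
    have h4 : Real.exp t = r * Real.exp (t - Real.log r) := by
      rw [Real.exp_sub, Real.exp_log (by linarith)]
      field_simp
    rw [h4]
    gcongr
    linarith
  have h5 : (r - 1) * t ≤ klFun r + t ^ 2 := by rw [klFun_apply]; linarith
  have h6 : r - 1 ≤ klFun r / t + t := by
    rw [div_add' _ _ _ ht.ne', le_div_iff₀ ht]
    linarith
  have h7 : r * Real.log r = klFun r + (r - 1) := by rw [klFun_apply]; ring
  rw [h7]
  calc klFun r + (r - 1) ≤ klFun r + (klFun r / t + t) := by linarith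
    _ = _ := by ring

/-- A density whose law is absolutely continuous with respect to that of `f` has Radon--Nikodym
derivative the quotient of the densities. -/
theorem ProbDensity.law_eq_withDensity_div {f₀ f : ProbDensity}
    (hac : (f₀.law : Measure ℝ) ≪ f.law) :
    (f₀.law : Measure ℝ) = (f.law : Measure ℝ).withDensity fun x => ENNReal.ofReal (f₀ x / f x) := by
  have hz : MeasurableSet {x | f x = 0} := f.measurable' (measurableSet_singleton 0)
  have h0 : (f.law : Measure ℝ) {x | f x = 0} = 0 := by
    rw [coe_law, withDensity_apply _ hz]
    refine (setLIntegral_congr_fun hz fun x hx => ?_).trans lintegral_zero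
    rw [show f x = 0 from hx, ENNReal.ofReal_zero]
  have h1 := hac h0
  rw [coe_law, withDensity_apply _ hz, setLIntegral_eq_zero_iff hz f₀.measurable_ofReal] at h1
  have hm : Measurable fun x => ENNReal.ofReal (f₀ x / f x) :=
    (f₀.measurable'.div f.measurable').ennreal_ofReal
  rw [coe_law, coe_law, ← withDensity_mul _ f.measurable_ofReal hm]
  refine withDensity_congr_ae ?_
  filter_upwards [h1] with x hx
  rw [Pi.mul_apply, ← ENNReal.ofReal_mul (f.nonneg' x)]
  by_cases hfx : f x = 0
  · rw [hx hfx, hfx, zero_mul, ENNReal.ofReal_zero]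
  · rw [mul_div_cancel₀ _ hfx]

open InformationTheory in
/-- A small Kullback--Leibler divergence makes the positive part of the log-ratio integrable with
small integral. -/
theorem lintegral_negLog_le_of_klDiv_lt {f₀ f : ProbDensity} {t : ℝ} (ht : 0 < t) (ht1 : t ≤ 1)
    (h : klDiv (f₀.law : Measure ℝ) (f.law : Measure ℝ) < ENNReal.ofReal (t ^ 2 / 2)) :
    ∫⁻ x, negLog (f x / f₀ x) ∂(f₀.law : Measure ℝ) ≤ ENNReal.ofReal (2 * t) := by
  obtain ⟨hac, -⟩ := klDiv_ne_top_iff.1 h.ne_top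
  have hr := ProbDensity.law_eq_withDensity_div hac
  have hrm : Measurable fun x => ENNReal.ofReal (f₀ x / f x) :=
    (f₀.measurable'.div f.measurable').ennreal_ofReal
  have hkm : Measurable fun x => ENNReal.ofReal (klFun (f₀ x / f x)) :=
    (measurable_klFun.comp (f₀.measurable'.div f.measurable')).ennreal_ofReal
  have hkl : klDiv (f₀.law : Measure ℝ) (f.law : Measure ℝ) =
      ∫⁻ x, ENNReal.ofReal (klFun (f₀ x / f x)) ∂(f.law : Measure ℝ) := by
    rw [klDiv_eq_lintegral_klFun_of_ac hac]
    refine lintegral_congr_ae ?_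
    have h1 := Measure.rnDeriv_withDensity (f.law : Measure ℝ) hrm
    rw [← hr] at h1
    filter_upwards [h1] with x hx
    rw [hx, ENNReal.toReal_ofReal (div_nonneg (f₀.nonneg' x) (f.nonneg' x))]
  have hpt : ∀ x, ENNReal.ofReal (f₀ x / f x) * negLog (f x / f₀ x) ≤
      ENNReal.ofReal (1 + 1 / t) * ENNReal.ofReal (klFun (f₀ x / f x)) + ENNReal.ofReal t := by
    intro x
    have hr0 : 0 ≤ f₀ x / f x := div_nonneg (f₀.nonneg' x) (f.nonneg' x)
    rw [← inv_div (f₀ x) (f x)]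
    generalize f₀ x / f x = r at hr0
    -- This covers `f₀ x = 0` and, by division by zero, `f x = 0`; the factor 0 cancels `negLog 0 =
    -- ∞`.
    by_cases hz : r = 0
    · simp [hz]
    rw [negLog, if_neg (inv_ne_zero hz), Real.log_inv, neg_neg, ← ENNReal.ofReal_mul hr0,
      ← ENNReal.ofReal_mul (by positivity),
      ← ENNReal.ofReal_add (mul_nonneg (by positivity) (klFun_nonneg hr0)) ht.le]
    rcases le_total 1 r with h1 | h1
    · exact ENNReal.ofReal_le_ofReal (mul_log_le_klFun h1 ht ht1)
    · rw [ENNReal.ofReal_of_nonpos (mul_nonpos_of_nonneg_of_nonpos hr0 (Real.log_nonpos hr0 h1))]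
      exact zero_le
  have hnm : Measurable fun x => negLog (f x / f₀ x) :=
    measurable_negLog.comp (f.measurable'.div f₀.measurable')
  calc ∫⁻ x, negLog (f x / f₀ x) ∂(f₀.law : Measure ℝ)
      = ∫⁻ x, ENNReal.ofReal (f₀ x / f x) * negLog (f x / f₀ x) ∂(f.law : Measure ℝ) := by
        conv_lhs => rw [hr]
        exact lintegral_withDensity_eq_lintegral_mul _ hrm hnm
    _ ≤ ∫⁻ x, (ENNReal.ofReal (1 + 1 / t) * ENNReal.ofReal (klFun (f₀ x / f x))
          + ENNReal.ofReal t) ∂(f.law : Measure ℝ) := lintegral_mono hpt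
    _ = ENNReal.ofReal (1 + 1 / t) * klDiv (f₀.law : Measure ℝ) (f.law : Measure ℝ)
          + ENNReal.ofReal t := by
        rw [lintegral_add_right _ measurable_const, lintegral_const_mul _ hkm, ← hkl,
          lintegral_const, measure_univ, mul_one]
    _ ≤ ENNReal.ofReal (1 + 1 / t) * ENNReal.ofReal (t ^ 2 / 2) + ENNReal.ofReal t := by
        gcongr
    _ ≤ ENNReal.ofReal (2 * t) := by
        rw [← ENNReal.ofReal_mul (by positivity), ← ENNReal.ofReal_add (by positivity) ht.le]
        refine ENNReal.ofReal_le_ofReal ?_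
        have : (1 + 1 / t) * (t ^ 2 / 2) = t ^ 2 / 2 + t / 2 := by field_simp
        nlinarith

theorem ofReal_likelihoodRatio (f₀ f : ProbDensity) (n : ℕ) (x : ℕ → ℝ) :
    ENNReal.ofReal (likelihoodRatio f₀ f n x) =
      ∏ i ∈ Finset.range n, ENNReal.ofReal (f (x i) / f₀ (x i)) :=
  ENNReal.ofReal_prod_of_nonneg fun _ _ => div_nonneg (f.nonneg' _) (f₀.nonneg' _)

/-! ### Lower bound for the evidence -/

section Sampling

variable {Ω : Type*} [MeasurableSpace Ω] {μ : Measure Ω} {X : ℕ → Ω → ℝ} {F : Set ProbDensity}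

theorem measurable_ratio (hX : ∀ i, Measurable (X i))
    (hF : Measurable (fun q : F × ℝ => q.1.1 q.2)) (f₀ : ProbDensity) (i : ℕ) :
    Measurable fun q : F × Ω => q.1.1 (X i q.2) / f₀ (X i q.2) :=
  (hF.comp (measurable_fst.prodMk ((hX i).comp measurable_snd))).div
    (f₀.measurable'.comp ((hX i).comp measurable_snd))

theorem measurable_ofReal_likelihoodRatio (hX : ∀ i, Measurable (X i))
    (hF : Measurable (fun q : F × ℝ => q.1.1 q.2)) (f₀ : ProbDensity) (n : ℕ) :
    Measurable fun q : F × Ω => ENNReal.ofReal (likelihoodRatio f₀ q.1.1 n fun i => X i q.2) := by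
  simp only [ofReal_likelihoodRatio]
  exact Finset.measurable_prod _ fun i _ => (measurable_ratio hX hF f₀ i).ennreal_ofReal

theorem lintegral_prod_comp_eq_pow {P : Measure ℝ} (hX : ∀ i, Measurable (X i))
    (hindep : iIndepFun X μ) (hlaw : ∀ i, μ.map (X i) = P) {ψ : ℝ → ℝ≥0∞} (hψ : Measurable ψ)
    (n : ℕ) : ∫⁻ ω, ∏ i ∈ Finset.range n, ψ (X i ω) ∂μ = (∫⁻ x, ψ x ∂P) ^ n := by
  rw [lintegral_prod_eq_prod_lintegral_of_indepFun (Finset.range n) (fun i ω => ψ (X i ω))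
    (hindep.comp (fun _ => ψ) fun _ => hψ) fun i => hψ.comp (hX i)]
  rw [Finset.prod_congr rfl fun i _ => ?_, Finset.prod_const, Finset.card_range]
  rw [← hlaw i, lintegral_map hψ (hX i)]

/-- Under the Kullback--Leibler support condition the denominator of the posterior does not decay
exponentially fast, with probability close to one. -/
theorem exists_evidence_lower_bound [IsProbabilityMeasure μ] (f₀ : ProbDensity)
    (hX : ∀ i, Measurable (X i)) (hlaw : ∀ i, μ.map (X i) = f₀.law)
    (hF : Measurable (fun q : F × ℝ => q.1.1 q.2))
    (prior : ℕ → Measure F) [∀ n, IsProbabilityMeasure (prior n)] (hKL : KLSupport f₀ prior)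
    {δ : ℝ} (hδ : 0 < δ) {κ : ℝ} (hκ : 0 < κ) :
    ∃ c : ℝ≥0∞, c ≠ 0 ∧ c ≠ ∞ ∧ ∀ᶠ n in atTop,
      μ {ω | ∫⁻ f, ENNReal.ofReal (likelihoodRatio f₀ f n fun i => X i ω) ∂(prior n) <
        c * ENNReal.ofReal (Real.exp (-δ)) ^ n} ≤ ENNReal.ofReal κ := by
  -- Markov's inequality below gives the bound `2 * t * n * β / (β / 2 * (n * δ)) = 4 * t / δ`, to
  -- be at most `κ`.
  set t : ℝ := min 1 (κ * δ / 4) with htdef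
  have ht : 0 < t := lt_min one_pos (by positivity)
  have ht1 : t ≤ 1 := min_le_left _ _
  have htκ : 4 * t ≤ κ * δ := by linarith [min_le_right 1 (κ * δ / 4)]
  obtain ⟨b, hb0, hb⟩ := exists_between (hKL (t ^ 2 / 2) (by positivity))
  have hbt : b ≠ ∞ := hb.ne_top
  refine ⟨b / 2, ENNReal.div_ne_zero.2 ⟨hb0.ne', by simp⟩, ENNReal.div_ne_top hbt (by simp), ?_⟩
  filter_upwards [eventually_lt_of_lt_liminf hb, eventually_ge_atTop 1] with n hbn hn
  -- This set contains a Kullback--Leibler ball and is measurable by joint measurability, so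
  -- measurability of the ball itself is not needed.
  set B : Set F := {f : F | ∫⁻ x, negLog (f.1 x / f₀ x) ∂(f₀.law : Measure ℝ) ≤
    ENNReal.ofReal (2 * t)} with hB
  have hBm : MeasurableSet B := by
    refine measurableSet_le ?_ measurable_const
    refine Measurable.lintegral_prod_right' (f := fun q : F × ℝ => negLog (q.1.1 q.2 / f₀ q.2)) ?_
    exact measurable_negLog.comp (hF.div (f₀.measurable'.comp measurable_snd))
  have hbB : b ≤ prior n B :=
    hbn.le.trans (measure_mono fun f hf => lintegral_negLog_le_of_klDiv_lt ht ht1 hf)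
  set β := prior n B with hβ
  have hβ0 : β ≠ 0 := (hb0.trans_le hbB).ne'
  have hβt : β ≠ ∞ := measure_ne_top _ _
  have hn0 : (0 : ℝ) < n := by exact_mod_cast hn
  have hnδ : 0 < n * δ := by positivity
  set N := ENNReal.ofReal (n * δ) with hN
  have hN0 : N ≠ 0 := (ENNReal.ofReal_pos.2 hnδ).ne'
  have hNt : N ≠ ∞ := ENNReal.ofReal_ne_top
  set L : F → Ω → ℝ≥0∞ := fun f ω => ∑ i ∈ Finset.range n, negLog (f.1 (X i ω) / f₀ (X i ω))
    with hL
  have hLm : Measurable (Function.uncurry L) :=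
    Finset.measurable_sum _ fun i _ => measurable_negLog.comp (measurable_ratio hX hF f₀ i)
  have hLf : ∀ f : F, f ∈ B → ∫⁻ ω, L f ω ∂μ ≤ n * ENNReal.ofReal (2 * t) := fun f hf => by
    have hm : Measurable fun x => negLog (f.1 x / f₀ x) :=
      measurable_negLog.comp (f.1.measurable'.div f₀.measurable')
    simp only [hL]
    rw [lintegral_finsetSum (f := fun i ω => negLog (f.1 (X i ω) / f₀ (X i ω))) _
      fun i _ => hm.comp (hX i)]
    calc ∑ i ∈ Finset.range n, ∫⁻ ω, negLog (f.1 (X i ω) / f₀ (X i ω)) ∂μ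
        ≤ ∑ i ∈ Finset.range n, ENNReal.ofReal (2 * t) := by
          refine Finset.sum_le_sum fun i _ => ?_
          rw [← lintegral_map hm (hX i), hlaw i]
          exact hf
      _ = n * ENNReal.ofReal (2 * t) := by simp
  set S : Ω → ℝ≥0∞ := fun ω => ∫⁻ f in B, L f ω ∂(prior n) with hS
  have hSm : Measurable S := Measurable.lintegral_prod_left' hLm
  have hSint : ∫⁻ ω, S ω ∂μ ≤ β * (n * ENNReal.ofReal (2 * t)) := by
    rw [hS, lintegral_lintegral_swap (f := fun ω f => L f ω)
      (hLm.comp measurable_swap).aemeasurable]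
    calc ∫⁻ f in B, ∫⁻ ω, L f ω ∂μ ∂(prior n)
        ≤ ∫⁻ f in B, n * ENNReal.ofReal (2 * t) ∂(prior n) := setLIntegral_mono' hBm hLf
      _ = β * (n * ENNReal.ofReal (2 * t)) := by rw [setLIntegral_const, mul_comm]
  -- If `S ω < β / 2 * N`, Markov's inequality in `f` leaves at least half of the prior mass of `B`
  -- with `L f ω < N`, hence with likelihood ratio at least `exp (-(n * δ))`.
  have hsub : {ω | ∫⁻ f, ENNReal.ofReal (likelihoodRatio f₀ f n fun i => X i ω) ∂(prior n) <
      b / 2 * ENNReal.ofReal (Real.exp (-δ)) ^ n} ⊆ {ω | β / 2 * N ≤ S ω} := by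
    intro ω hω
    by_contra hlt
    simp only [Set.mem_ofPred_eq, not_le] at hlt
    rw [Set.mem_ofPred_eq] at hω
    refine absurd hω (not_lt.2 ?_)
    have hLω : Measurable fun f : F => L f ω := hLm.comp (measurable_id.prodMk measurable_const)
    have hgood : MeasurableSet {f : F | L f ω < N} := measurableSet_lt hLω measurable_const
    have hbad : (prior n).restrict B {f | N ≤ L f ω} ≤ β / 2 := by
      have h1 := (mul_meas_ge_le_lintegral (μ := (prior n).restrict B) hLω N).trans hlt.le
      rw [mul_comm] at h1
      exact (ENNReal.mul_le_mul_iff_left hN0 hNt).1 h1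
    have hmass : β / 2 ≤ (prior n).restrict B {f | L f ω < N} := by
      have h1 : β = (prior n).restrict B {f | L f ω < N} + (prior n).restrict B {f | N ≤ L f ω} := by
        have h2 := measure_add_measure_compl (μ := (prior n).restrict B) hgood
        rw [Measure.restrict_apply_univ] at h2
        rw [hβ, ← h2]
        congr 2
        ext f
        simp
      have h3 : β / 2 + β / 2 ≤ (prior n).restrict B {f | L f ω < N} + β / 2 := by
        rw [ENNReal.add_halves]
        exact h1.le.trans (by gcongr)
      exact (ENNReal.add_le_add_iff_right (ENNReal.div_ne_top hβt (by simp))).1 h3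
    calc b / 2 * ENNReal.ofReal (Real.exp (-δ)) ^ n
        ≤ β / 2 * ENNReal.ofReal (Real.exp (-(n * δ))) := by
          rw [← ENNReal.ofReal_pow (Real.exp_pos _).le, ← Real.exp_nat_mul, mul_neg]
          gcongr
      _ ≤ ENNReal.ofReal (Real.exp (-(n * δ))) * (prior n).restrict B {f | L f ω < N} := by
          rw [mul_comm]
          gcongr
      _ = ∫⁻ _ in {f | L f ω < N}, ENNReal.ofReal (Real.exp (-(n * δ)))
            ∂((prior n).restrict B) := (setLIntegral_const _ _).symm
      _ ≤ ∫⁻ f in {f | L f ω < N}, ENNReal.ofReal (likelihoodRatio f₀ f n fun i => X i ω)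
            ∂((prior n).restrict B) := by
          refine setLIntegral_mono' hgood fun f hf => ENNReal.ofReal_le_ofReal ?_
          exact exp_neg_le_prod (fun i _ => div_nonneg (f.1.nonneg' _) (f₀.nonneg' _)) hnδ.le
            (le_of_lt hf)
      _ ≤ ∫⁻ f, ENNReal.ofReal (likelihoodRatio f₀ f n fun i => X i ω) ∂(prior n) :=
          lintegral_mono' (Measure.restrict_le_self.trans Measure.restrict_le_self) le_rfl
  have hβN0 : β / 2 * N ≠ 0 := mul_ne_zero (ENNReal.div_ne_zero.2 ⟨hβ0, by simp⟩) hN0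
  have hβNt : β / 2 * N ≠ ∞ := ENNReal.mul_ne_top (ENNReal.div_ne_top hβt (by simp)) hNt
  refine (measure_mono hsub).trans ((meas_ge_le_lintegral_div hSm.aemeasurable hβN0 hβNt).trans ?_)
  refine ENNReal.div_le_of_le_mul (hSint.trans ?_)
  have hkey : (n : ℝ≥0∞) * ENNReal.ofReal (2 * t) ≤ ENNReal.ofReal κ * (N / 2) := by
    rw [hN, ← ENNReal.ofReal_natCast, ← ENNReal.ofReal_mul (by positivity),
      show (2 : ℝ≥0∞) = ENNReal.ofReal 2 by simp, ← ENNReal.ofReal_div_of_pos two_pos,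
      ← ENNReal.ofReal_mul hκ.le]
    refine ENNReal.ofReal_le_ofReal ?_
    nlinarith
  calc β * (n * ENNReal.ofReal (2 * t)) ≤ β * (ENNReal.ofReal κ * (N / 2)) := by gcongr
    _ = ENNReal.ofReal κ * (β / 2 * N) := by
        rw [ENNReal.div_eq_inv_mul, ENNReal.div_eq_inv_mul]; ring

end Sampling

/-! ### Exponential weights -/

/-- An exponential moment bound for a bounded function with negative mean. -/
theorem lintegral_exp_le {E : Type*} [MeasurableSpace E] (P : Measure E) [IsProbabilityMeasure P]
    {v : E → ℝ} (hv : Measurable v) {B : ℝ} (hB1 : B ≤ 1) (hvB : ∀ x, |v x| ≤ B) {m : ℝ}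
    (hm : ∫ x, v x ∂P ≤ m) :
    ∫⁻ x, ENNReal.ofReal (Real.exp (v x)) ∂P ≤ ENNReal.ofReal (Real.exp (m + B ^ 2)) := by
  have hvi : Integrable v P :=
    Integrable.of_bound hv.aestronglyMeasurable B (ae_of_all _ fun x => hvB x)
  have hpt : ∀ x, Real.exp (v x) ≤ 1 + B ^ 2 + v x := fun x => by
    have h1 := (abs_le.1 (Real.abs_exp_sub_one_sub_id_le ((hvB x).trans hB1))).2
    have h2 : v x ^ 2 ≤ B ^ 2 := by
      rw [← sq_abs (v x)]
      exact pow_le_pow_left₀ (abs_nonneg _) (hvB x) 2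
    linarith
  have hint : Integrable (fun x => 1 + B ^ 2 + v x) P := (integrable_const _).add hvi
  calc ∫⁻ x, ENNReal.ofReal (Real.exp (v x)) ∂P
      ≤ ∫⁻ x, ENNReal.ofReal (1 + B ^ 2 + v x) ∂P :=
        lintegral_mono fun x => ENNReal.ofReal_le_ofReal (hpt x)
    _ = ENNReal.ofReal (∫ x, (1 + B ^ 2 + v x) ∂P) :=
        (ofReal_integral_eq_lintegral_ofReal hint
          (ae_of_all _ fun x => (Real.exp_pos _).le.trans (hpt x))).symm
    _ ≤ ENNReal.ofReal (Real.exp (m + B ^ 2)) := by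
        refine ENNReal.ofReal_le_ofReal ?_
        rw [integral_add (integrable_const _) hvi, integral_const, probReal_univ, one_smul]
        linarith [Real.add_one_le_exp (m + B ^ 2)]

/-- Exponential weights that separate a probability measure from the measures with a smaller
integral of a bounded function. -/
theorem exists_exponential_weight {E : Type*} [MeasurableSpace E] (Q : Measure E)
    [IsProbabilityMeasure Q] {g : E → ℝ≥0∞} (hg : Measurable g) {C : ℝ≥0∞} (hC : C ≠ ∞)
    (hgC : ∀ x, g x ≤ C) {t : ℝ≥0∞} (ht : t < ∫⁻ x, g x ∂Q) :
    ∃ (v : E → ℝ) (δ : ℝ), Measurable v ∧ 0 < δ ∧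
      ∫⁻ x, ENNReal.ofReal (Real.exp (-v x)) ∂Q ≤ ENNReal.ofReal (Real.exp (-(2 * δ))) ∧
      ∀ P : Measure E, IsProbabilityMeasure P → ∫⁻ x, g x ∂P ≤ t →
        ∫⁻ x, ENNReal.ofReal (Real.exp (v x)) ∂P ≤ ENNReal.ofReal (Real.exp (-(2 * δ))) := by
  have hgt : ∀ x, g x < ∞ := fun x => (hgC x).trans_lt hC.lt_top
  have hfin : ∀ P : Measure E, IsProbabilityMeasure P → ∫⁻ x, g x ∂P ≤ C := fun P _ =>
    (lintegral_mono hgC).trans_eq (by simp)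
  have hGint : ∀ P : Measure E, ∫ x, (g x).toReal ∂P = (∫⁻ x, g x ∂P).toReal := fun P =>
    integral_toReal hg.aemeasurable (ae_of_all _ hgt)
  have hGm : Measurable fun x => (g x).toReal := hg.ennreal_toReal
  have hG0 : ∀ x, 0 ≤ (g x).toReal := fun x => ENNReal.toReal_nonneg
  have hGC : ∀ x, (g x).toReal ≤ C.toReal := fun x => ENNReal.toReal_mono hC (hgC x)
  have hGi : ∀ P : Measure E, IsProbabilityMeasure P → Integrable (fun x => (g x).toReal) P :=
    fun P _ => Integrable.of_bound hGm.aestronglyMeasurable C.toReal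
      (ae_of_all _ fun x => by rw [Real.norm_of_nonneg (hG0 x)]; exact hGC x)
  set m := (∫⁻ x, g x ∂Q).toReal with hm
  have hm0 : 0 ≤ m := ENNReal.toReal_nonneg
  set d := (m - t.toReal) / 2 with hd
  have hd0 : 0 < d := by
    have : t.toReal < m :=
      (ENNReal.toReal_lt_toReal ht.ne_top (ne_top_of_le_ne_top hC (hfin Q inferInstance))).2 ht
    rw [hd]; linarith
  have hC0 : 0 ≤ C.toReal := ENNReal.toReal_nonneg
  set K := C.toReal + m + d with hK
  have hK0 : 0 < K := by positivity
  have hdK : d ≤ K := by linarith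
  -- This minimises `-(l * d) + (l * K) ^ 2`, with minimum `-d ^ 2 / (4 * K ^ 2)`. Centring `g` at
  -- the midpoint `m - d` of `t` and `m` gives `v` mean `l * d` under `Q` and at most `-(l * d)`
  -- under `P`.
  set l := d / (2 * K ^ 2) with hl
  have hl0 : 0 < l := by positivity
  have hlK : l * K = d / (2 * K) := by rw [hl]; field_simp
  have hlK1 : l * K ≤ 1 := by
    rw [hlK, div_le_one (by positivity)]; linarith
  set v : E → ℝ := fun x => l * ((g x).toReal - m + d) with hv
  have hvm : Measurable v := ((hGm.sub_const m).add_const d).const_mul l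
  have hvB : ∀ x, |v x| ≤ l * K := fun x => by
    rw [hv, abs_mul, abs_of_pos hl0]
    gcongr
    rw [abs_le]
    constructor <;> linarith [hG0 x, hGC x]
  have hvint : ∀ P : Measure E, IsProbabilityMeasure P →
      ∫ x, v x ∂P = l * ((∫⁻ x, g x ∂P).toReal - m + d) := fun P hP => by
    have hsub : Integrable (fun x => (g x).toReal - m) P := (hGi P hP).sub (integrable_const _)
    rw [hv, integral_const_mul, integral_add hsub (integrable_const _), integral_sub (hGi P hP) (integrable_const _), hGint]
    simp
  have hexp : -(l * d) + (l * K) ^ 2 = -(2 * (d ^ 2 / (8 * K ^ 2))) := by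
    rw [hl]; field_simp; ring
  refine ⟨v, d ^ 2 / (8 * K ^ 2), hvm, by positivity, ?_, fun P hP hPt => ?_⟩
  · rw [← hexp]
    refine lintegral_exp_le Q hvm.neg hlK1 (fun x => ?_) ?_
    · rw [Pi.neg_apply, abs_neg]; exact hvB x
    · simp only [Pi.neg_apply]
      rw [integral_neg, hvint Q inferInstance, sub_self, zero_add]
  · rw [← hexp]
    refine lintegral_exp_le P hvm hlK1 hvB ?_
    rw [hvint P hP, ← mul_neg]
    have : (∫⁻ x, g x ∂P).toReal ≤ t.toReal := ENNReal.toReal_mono ht.ne_top hPt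
    gcongr
    linarith

/-! ### Vanishing posterior mass and Schwartz's theorem -/

section Posterior

variable {F : Set ProbDensity}

theorem posterior_mono (f₀ : ProbDensity) (prior : Measure F) (n : ℕ) (x : ℕ → ℝ) {A B : Set F}
    (h : A ⊆ B) : posterior f₀ prior n x A ≤ posterior f₀ prior n x B := by
  unfold _root_.posterior
  gcongr

/-- Subadditivity holds for arbitrary sets, so the moment and Wasserstein events need no
measurability proof. -/
theorem posterior_union_le (f₀ : ProbDensity) (prior : Measure F) (n : ℕ) (x : ℕ → ℝ)
    (A B : Set F) :
    posterior f₀ prior n x (A ∪ B) ≤ posterior f₀ prior n x A + posterior f₀ prior n x B := by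
  unfold _root_.posterior
  rw [← ENNReal.add_div]
  gcongr
  exact lintegral_union_le _ _ _

theorem posterior_le_one (f₀ : ProbDensity) (prior : Measure F) (n : ℕ) (x : ℕ → ℝ) (A : Set F) :
    posterior f₀ prior n x A ≤ 1 :=
  (ENNReal.div_le_div_right (setLIntegral_le_lintegral _ _) _).trans ENNReal.div_self_le_one

variable {Ω : Type*} [MeasurableSpace Ω] {μ : Measure Ω} {X : ℕ → Ω → ℝ} {f₀ : ProbDensity}
  {prior : ℕ → Measure F}

/-- The posterior is at most 1, even when the evidence is 0 or `∞`, so `toReal` loses nothing. -/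
theorem posteriorVanishes_iff {A : Set F} :
    PosteriorVanishes μ X f₀ prior A ↔ ∀ ε : ℝ≥0∞, 0 < ε →
      Tendsto (fun n => μ {ω | ε ≤ posterior f₀ (prior n) n (fun i => X i ω) A}) atTop (𝓝 0) := by
  unfold PosteriorVanishes TendstoInMeasure
  refine forall₂_congr fun ε _ => ?_
  have : ∀ n ω, edist (posterior f₀ (prior n) n (fun i => X i ω) A).toReal 0 =
      posterior f₀ (prior n) n (fun i => X i ω) A := fun n ω => by
    rw [edist_dist, Real.dist_0_eq_abs, abs_of_nonneg ENNReal.toReal_nonneg,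
      ENNReal.ofReal_toReal (ne_top_of_le_ne_top ENNReal.one_ne_top (posterior_le_one ..))]
  simp only [this]

theorem PosteriorVanishes.mono {A B : Set F} (hB : PosteriorVanishes μ X f₀ prior B)
    (h : A ⊆ B) : PosteriorVanishes μ X f₀ prior A := by
  rw [posteriorVanishes_iff] at hB ⊢
  refine fun ε hε => tendsto_of_tendsto_of_tendsto_of_le_of_le tendsto_const_nhds (hB ε hε)
    (fun _ => zero_le) fun n => measure_mono fun ω hω => ?_
  exact le_trans (b := posterior f₀ (prior n) n (fun i => X i ω) A) hω (posterior_mono _ _ _ _ h)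

theorem PosteriorVanishes.union {A B : Set F} (hA : PosteriorVanishes μ X f₀ prior A)
    (hB : PosteriorVanishes μ X f₀ prior B) : PosteriorVanishes μ X f₀ prior (A ∪ B) := by
  rw [posteriorVanishes_iff] at hA hB ⊢
  intro ε hε
  have hε2 : 0 < ε / 2 := ENNReal.half_pos hε.ne'
  have hsum := (hA _ hε2).add (hB _ hε2)
  rw [add_zero] at hsum
  refine tendsto_of_tendsto_of_tendsto_of_le_of_le tendsto_const_nhds hsum
    (fun _ => zero_le) fun n => (measure_mono fun ω hω => ?_).trans (measure_union_le _ _)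
  by_contra hcon
  rw [Set.mem_union, not_or, Set.mem_ofPred_eq, Set.mem_ofPred_eq, not_le, not_le] at hcon
  rw [Set.mem_ofPred_eq] at hω
  refine absurd (hω.trans (posterior_union_le _ _ _ _ A B)) (not_le.2 ?_)
  exact (ENNReal.add_lt_add hcon.1 hcon.2).trans_eq (ENNReal.add_halves ε)

theorem posteriorVanishes_empty : PosteriorVanishes μ X f₀ prior ∅ := by
  rw [posteriorVanishes_iff]
  intro ε hε
  simp [_root_.posterior, hε.ne']

theorem PosteriorVanishes.biUnion {ι : Type*} (s : Finset ι) {A : ι → Set F}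
    (hA : ∀ i ∈ s, PosteriorVanishes μ X f₀ prior (A i)) :
    PosteriorVanishes μ X f₀ prior (⋃ i ∈ s, A i) := by
  classical
  induction s using Finset.induction_on with
  | empty => simpa using posteriorVanishes_empty
  | insert i s _ ih =>
    rw [Finset.set_biUnion_insert]
    exact (hA i (Finset.mem_insert_self _ _)).union
      (ih fun j hj => hA j (Finset.mem_insert_of_mem hj))

/-- Schwartz's theorem: under the Kullback--Leibler support condition, the posterior gives
vanishing mass to the densities for which the integral of a fixed bounded function is too small. -/
theorem posteriorVanishes_lintegral_le [IsProbabilityMeasure μ] (hX : ∀ i, Measurable (X i))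
    (hindep : iIndepFun X μ) (hlaw : ∀ i, μ.map (X i) = f₀.law)
    (hF : Measurable (fun q : F × ℝ => q.1.1 q.2)) [∀ n, IsProbabilityMeasure (prior n)]
    (hKL : KLSupport f₀ prior) {g : ℝ → ℝ≥0∞} (hg : Measurable g) {C : ℝ≥0∞} (hC : C ≠ ∞)
    (hgC : ∀ x, g x ≤ C) {t : ℝ≥0∞} (ht : t < ∫⁻ x, g x ∂(f₀.law : Measure ℝ)) :
    PosteriorVanishes μ X f₀ prior {f : F | ∫⁻ x, g x ∂(f.1.law : Measure ℝ) ≤ t} := by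
  obtain ⟨v, δ, hvm, hδ, hv0, hvt⟩ := exists_exponential_weight _ hg hC hgC ht
  set A := {f : F | ∫⁻ x, g x ∂(f.1.law : Measure ℝ) ≤ t} with hA
  have hAm : MeasurableSet A := by
    simp only [hA, ProbDensity.lintegral_law _ hg]
    refine measurableSet_le ?_ measurable_const
    exact Measurable.lintegral_prod_right'
      (f := fun q : F × ℝ => ENNReal.ofReal (q.1.1 q.2) * g q.2)
      (hF.ennreal_ofReal.mul (hg.comp measurable_snd))
  set σ := ENNReal.ofReal (Real.exp (-δ)) with hσ
  have hσ0 : σ ≠ 0 := (ENNReal.ofReal_pos.2 (Real.exp_pos _)).ne'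
  have hσt : σ ≠ ∞ := ENNReal.ofReal_ne_top
  have hσ1 : σ < 1 := by
    rw [hσ, ENNReal.ofReal_lt_one, Real.exp_lt_one_iff]
    linarith
  have hσσ : ENNReal.ofReal (Real.exp (-(2 * δ))) = σ * σ := by
    rw [hσ, ← ENNReal.ofReal_mul (Real.exp_pos _).le, ← Real.exp_add]
    congr 2
    ring
  rw [hσσ] at hv0 hvt
  set ψ : ℝ → ℝ≥0∞ := fun x => ENNReal.ofReal (Real.exp (v x)) with hψ
  set χ : ℝ → ℝ≥0∞ := fun x => ENNReal.ofReal (Real.exp (-v x)) with hχ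
  have hψm : Measurable ψ := hvm.exp.ennreal_ofReal
  have hχm : Measurable χ := hvm.neg.exp.ennreal_ofReal
  have hψχ : ∀ (n : ℕ) (x : ℕ → ℝ),
      (∏ i ∈ Finset.range n, ψ (x i)) * ∏ i ∈ Finset.range n, χ (x i) = 1 := fun n x => by
    rw [← Finset.prod_mul_distrib]
    refine Finset.prod_eq_one fun i _ => ?_
    rw [hψ, hχ, ← ENNReal.ofReal_mul (Real.exp_pos _).le, ← Real.exp_add, add_neg_cancel,
      Real.exp_zero, ENNReal.ofReal_one]
  set Z : ℕ → F → Ω → ℝ≥0∞ := fun n f ω =>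
    ∏ i ∈ Finset.range n, (ENNReal.ofReal (f.1 (X i ω) / f₀ (X i ω)) * ψ (X i ω)) with hZ
  have hZm : ∀ n, Measurable (Function.uncurry (Z n)) := fun n =>
    Finset.measurable_prod _ fun i _ => (measurable_ratio hX hF f₀ i).ennreal_ofReal.mul
      (hψm.comp ((hX i).comp measurable_snd))
  have hZint : ∀ n, ∀ f ∈ A, ∫⁻ ω, Z n f ω ∂μ ≤ (σ * σ) ^ n := fun n f hf => by
    have hm : Measurable fun x => ENNReal.ofReal (f.1 x / f₀ x) * ψ x :=
      (f.1.measurable'.div f₀.measurable').ennreal_ofReal.mul hψm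
    rw [hZ, lintegral_prod_comp_eq_pow hX hindep hlaw hm]
    gcongr
    exact (f₀.lintegral_ratio_mul_le f.1 hψm).trans (hvt _ inferInstance hf)
  set W : ℕ → Ω → ℝ≥0∞ := fun n ω => ∫⁻ f in A, Z n f ω ∂(prior n) with hW
  have hWm : ∀ n, Measurable (W n) := fun n => Measurable.lintegral_prod_left' (hZm n)
  have hWint : ∀ n, ∫⁻ ω, W n ω ∂μ ≤ (σ * σ) ^ n := fun n => by
    rw [hW, lintegral_lintegral_swap (f := fun ω f => Z n f ω)
      ((hZm n).comp measurable_swap).aemeasurable]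
    calc ∫⁻ f in A, ∫⁻ ω, Z n f ω ∂μ ∂(prior n) ≤ ∫⁻ f in A, (σ * σ) ^ n ∂(prior n) :=
          setLIntegral_mono' hAm (hZint n)
      _ ≤ (σ * σ) ^ n := by
          rw [setLIntegral_const]
          exact mul_le_of_le_one_right zero_le prob_le_one
  rw [posteriorVanishes_iff]
  suffices h : ∀ ε : ℝ≥0∞, 0 < ε → ε ≠ ∞ →
      Tendsto (fun n => μ {ω | ε ≤ posterior f₀ (prior n) n (fun i => X i ω) A}) atTop (𝓝 0) by
    intro ε hε
    refine tendsto_of_tendsto_of_tendsto_of_le_of_le tendsto_const_nhds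
      (h (min ε 1) (lt_min hε one_pos) (by simp)) (fun _ => zero_le)
      fun n => measure_mono fun ω hω => ?_
    exact (min_le_left ε 1).trans hω
  intro ε hε hεt
  rw [ENNReal.tendsto_nhds_zero]
  intro κ hκ
  -- Three exceptional events share the bound; the minimum with 1 keeps it finite.
  set κ' := min κ 1 / 3 with hκ'
  have hκ'0 : κ' ≠ 0 := ENNReal.div_ne_zero.2 ⟨(lt_min hκ one_pos).ne', by simp⟩
  have hκ't : κ' ≠ ∞ := ENNReal.div_ne_top (by simp) (by simp)
  obtain ⟨c, hc0, hct, hev⟩ := exists_evidence_lower_bound f₀ hX hlaw hF prior hKL hδ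
    (ENNReal.toReal_pos hκ'0 hκ't)
  rw [ENNReal.ofReal_toReal hκ't] at hev
  have hpow : Tendsto (fun n : ℕ => σ ^ n) atTop (𝓝 0) :=
    ENNReal.tendsto_pow_atTop_nhds_zero_of_lt_one hσ1
  have hεc0 : ε * c ≠ 0 := mul_ne_zero hε.ne' hc0
  have hεct : ε * c ≠ ∞ := ENNReal.mul_ne_top hεt hct
  have hpow' : Tendsto (fun n : ℕ => σ ^ n / (ε * c)) atTop (𝓝 0) := by
    simpa using ENNReal.Tendsto.div_const hpow (Or.inr hεc0)
  filter_upwards [hev, ENNReal.tendsto_nhds_zero.1 hpow κ' (pos_iff_ne_zero.2 hκ'0),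
    ENNReal.tendsto_nhds_zero.1 hpow' κ' (pos_iff_ne_zero.2 hκ'0)] with n hn1 hn2 hn3
  have hσn0 : σ ^ n ≠ 0 := pow_ne_zero _ hσ0
  have hσnt : σ ^ n ≠ ∞ := ENNReal.pow_ne_top hσt
  have hT0 : ε * c * σ ^ n ≠ 0 := mul_ne_zero hεc0 hσn0
  have hTt : ε * c * σ ^ n ≠ ∞ := ENNReal.mul_ne_top hεct hσnt
  -- Off these events the weight exceeds 1, so `W n` dominates the numerator; the evidence is at
  -- least `c * σ ^ n`; and `W n` is below `ε` times that bound.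
  have hsub : {ω | ε ≤ posterior f₀ (prior n) n (fun i => X i ω) A} ⊆
      {ω | 1 ≤ ∏ i ∈ Finset.range n, χ (X i ω)} ∪
      ({ω | ∫⁻ f, ENNReal.ofReal (likelihoodRatio f₀ f n fun i => X i ω) ∂(prior n) < c * σ ^ n} ∪
        {ω | ε * c * σ ^ n ≤ W n ω}) := by
    intro ω hω
    by_contra hcon
    simp only [Set.mem_union, Set.mem_ofPred_eq, not_or, not_le, not_lt] at hcon hω
    obtain ⟨h1, h2, h3⟩ := hcon
    have hψ1 : 1 ≤ ∏ i ∈ Finset.range n, ψ (X i ω) := by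
      by_contra hlt
      rw [not_le] at hlt
      exact absurd (hψχ n fun i => X i ω) (ENNReal.mul_lt_mul hlt h1 |>.trans_eq (mul_one 1)).ne
    have hnum : ∫⁻ f in A, ENNReal.ofReal (likelihoodRatio f₀ f n fun i => X i ω) ∂(prior n) ≤
        W n ω := by
      refine lintegral_mono fun f => ?_
      simp only [hZ, Finset.prod_mul_distrib, ofReal_likelihoodRatio]
      exact le_mul_of_one_le_right zero_le hψ1
    refine absurd hω (not_le.2 ?_)
    calc posterior f₀ (prior n) n (fun i => X i ω) A ≤ W n ω / (c * σ ^ n) :=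
          ENNReal.div_le_div hnum h2
      _ < ε := by
          refine ENNReal.div_lt_of_lt_mul ?_
          rwa [← mul_assoc]
  refine (measure_mono hsub).trans ((measure_union_le _ _).trans ?_)
  have e1 : μ {ω | 1 ≤ ∏ i ∈ Finset.range n, χ (X i ω)} ≤ κ' := by
    have hm : Measurable fun ω => ∏ i ∈ Finset.range n, χ (X i ω) :=
      Finset.measurable_prod _ fun i _ => hχm.comp (hX i)
    refine (meas_ge_le_lintegral_div hm.aemeasurable one_ne_zero ENNReal.one_ne_top).trans ?_
    rw [div_one, lintegral_prod_comp_eq_pow hX hindep hlaw hχm]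
    calc (∫⁻ x, χ x ∂(f₀.law : Measure ℝ)) ^ n ≤ (σ * σ) ^ n := by gcongr
      _ ≤ σ ^ n := by gcongr; exact mul_le_of_le_one_right zero_le hσ1.le
      _ ≤ κ' := hn2
  have e3 : μ {ω | ε * c * σ ^ n ≤ W n ω} ≤ κ' := by
    refine (meas_ge_le_lintegral_div (hWm n).aemeasurable hT0 hTt).trans (le_trans ?_ hn3)
    refine ENNReal.div_le_of_le_mul ((hWint n).trans ?_)
    rw [mul_pow, ← mul_assoc, ENNReal.div_mul_cancel hεc0 hεct]
  calc _ ≤ κ' + (κ' + κ') := add_le_add e1 ((measure_union_le _ _).trans (add_le_add hn1 e3))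
    _ = min κ 1 := by rw [← add_assoc, ENNReal.add_thirds]
    _ ≤ κ := min_le_left _ _

end Posterior

/-! ### The equivalence -/

theorem mainTheorem4 {Ω : Type*} [MeasurableSpace Ω] (μ : Measure Ω) [IsProbabilityMeasure μ]
    (p : ℝ) (hp : 1 ≤ p)
    (f₀ : ProbDensity) (hf₀ : absMoment p f₀.law < ∞)
    (X : ℕ → Ω → ℝ) (hX : ∀ i, Measurable (X i)) (hindep : iIndepFun X μ)
    (hlaw : ∀ i, μ.map (X i) = f₀.law)
    (F : Set ProbDensity) (hF : Measurable (fun q : F × ℝ => q.1.1 q.2))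
    (prior : ℕ → Measure F) [∀ n, IsProbabilityMeasure (prior n)]
    (hKL : KLSupport f₀ prior) :
    MomentConsistent μ X f₀ prior p ↔ WassersteinConsistent μ X f₀ prior p := by
  constructor
  · intro hmom ε hε
    obtain ⟨δ, w, G, hδ, hw, hG, htest⟩ :=
      exists_tests_wasserstein_lt hp (f₀.law : Measure ℝ) hf₀ hε
    have hvan : ∀ g ∈ G, PosteriorVanishes μ X f₀ prior {f : F |
        ∫⁻ x, g x ∂(f.1.law : Measure ℝ) < w * ∫⁻ x, g x ∂(f₀.law : Measure ℝ)} := by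
      intro g hg
      obtain ⟨hgm, C, hC, hgC⟩ := hG g hg
      -- If the integral is 0, the strict test cannot fail; otherwise `w < 1` puts the threshold
      -- strictly below it, as Schwartz's theorem requires.
      by_cases h0 : ∫⁻ x, g x ∂(f₀.law : Measure ℝ) = 0
      · refine posteriorVanishes_empty.mono fun f hf => ?_
        rw [Set.mem_ofPred_eq, h0, mul_zero] at hf
        exact absurd hf not_lt_zero
      · have hfin : ∫⁻ x, g x ∂(f₀.law : Measure ℝ) ≠ ∞ :=
          ne_top_of_le_ne_top hC ((lintegral_mono hgC).trans_eq (by simp))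
        refine (posteriorVanishes_lintegral_le hX hindep hlaw hF hKL hgm hC hgC
          (t := w * ∫⁻ x, g x ∂(f₀.law : Measure ℝ)) ?_).mono fun f hf => ?_
        swap
        · rw [Set.mem_ofPred_eq] at hf ⊢
          exact hf.le
        calc w * ∫⁻ x, g x ∂(f₀.law : Measure ℝ) < 1 * ∫⁻ x, g x ∂(f₀.law : Measure ℝ) :=
              ENNReal.mul_lt_mul_left h0 hfin hw
          _ = _ := one_mul _
    refine ((hmom δ hδ).union (PosteriorVanishes.biUnion G hvan)).mono fun f hf => ?_
    by_contra hcon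
    rw [Set.mem_union, not_or, Set.mem_ofPred_eq, not_lt, Set.mem_iUnion₂] at hcon
    refine absurd hf (not_le.2 (htest _ inferInstance hcon.1 fun g hg => ?_))
    by_contra hlt
    exact hcon.2 ⟨g, hg, not_le.1 hlt⟩
  · intro hW ε hε
    obtain ⟨δ, hδ, hclose⟩ := exists_absDiff_le_of_wasserstein_lt hp hf₀ hε
    refine (hW δ hδ).mono fun f hf => ?_
    by_contra hcon
    rw [Set.mem_ofPred_eq, not_le] at hcon
    exact absurd hf (not_lt.2 (hclose _ hcon))
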